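/- **Definitions.** A Priestley space is a compact topological space $X$ with a partial order such that whenever $x\nleq y$ there is a clopen upset $U$ with $x\in U$, $y\notin U$; it is an Esakia space if moreover ${\downarrow}U$ is clopen for every clopen $U\subseteq X$. Let $\mathbf{Pries}$ be the category of Priestley spaces and monotone continuous maps, and $\mathbf{Esa}$ the category of Esakia spaces and continuous p-morphisms (monotone continuous maps $f$ such that $f(x)\leq y$ implies $f(x')=y$ for some $x'\geq x$). Let $I:\mathbf{Esa}\to\mathbf{Pries}$ be the inclusion. For clopen upsets $A,B$ of $X$, their relative pseudocomplement $A\to B$, if it exists, is the largest clopen upset $C$ of $X$ with $C\cap A\subseteq B$. Given monotone continuous maps $f:S\to X$ and $g:X\to Y$, the map $f$ is $g$-open if $f^{-1}$ preserves all existing relative pseudocomplements $g^{-1}[U]\to g^{-1}[V]$, where $U,V$ are clopen upsets of $Y$. A closed subset $S\subseteq X$ is $g$-open if its inclusion into $X$ is; $S$ is rooted if it has a least element, its root. Let $V_g(X)$ be the set of closed, rooted, $g$-open subsets of $X$, with the Vietoris topology, generated by the sets $\{C: C\subseteq U\}$ and $\{C: C\cap U\neq\emptyset\}$ for $U\subseteq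 X$ open (equivalently, clopen), and ordered by reverse inclusion; let $r_g:V_g(X)\to X$ send a subset to its root. For a Priestley space $X$ put $V_0(X)=X$, let $r_0:X\to\{\bullet\}$ be the map to the one-point space, and put $V_{n+1}(X)=V_{r_n}(V_n(X))$ and $r_{n+1}=r_{r_n}:V_{n+1}(X)\to V_n(X)$. Let $V_G(X)$ be the inverse limit of this sequence, that is, the set of sequences $(x_n)_{n\ge 0}$ with $x_n\in V_n(X)$ and $r_{n+1}(x_{n+1})=x_n$, with the topology and order inherited from $\prod_n V_n(X)$, and let $\pi_0:V_G(X)\to X$ be the projection $(x_n)_n\mapsto x_0$. **Theorem.** For every Priestley space $X$ the space $V_G(X)$ is an Esakia space, and for every monotone continuous map $p:X\to Y$ of Priestley spaces there is a unique continuous p-morphism $\overline{p}:V_G(X)\to V_G(Y)$ with $\pi_0\overline{p}=p\,\pi_0$. The functor $V_G:\mathbf{Pries}\to\mathbf{Esa}$, $X\mapsto V_G(X)$, $p\mapsto\overline{p}$, so obtained is right adjoint to the inclusion $I:\mathbf{Esa}\to\mathbf{Pries}$, by an adjunction whose counit at a Priestley space $X$ is $\pi_0:V_G(X)\to X$, and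 whose unit at an Esakia space $Z$ is the map $$\eta_Z(z)=(\eta_0(z),\eta_1(z),\eta_2(z),\dots),\qquad \eta_0(z)=z,\qquad \eta_{n+1}(z)=\eta_n[{\uparrow}z]=\{\eta_n(w): w\geq z\}\subseteq V_n(Z),$$ i.e. $z\mapsto (z,\ {\uparrow}z,\ \{{\uparrow}w: w\geq z\},\ \dots)$. -/

import Mathlib

open CategoryTheory

universe u

namespace GhilardiComplex

/-! ## Esakia spaces and the two categories -/

/-- An Esakia space is a (compact) Priestley space in which the downset generated by a clopen set
is clopen. -/
class EsakiaSpace (X : Type u) [TopologicalSpace X] [PartialOrder X] : Prop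
    extends CompactSpace X, PriestleySpace X where
  isClopen_lowerClosure : ∀ U : Set X, IsClopen U → IsClopen (lowerClosure U : Set X)

/-- Objects of the category of Priestley spaces. -/
structure Pries : Type (u + 1) where
  carrier : Type u
  [top : TopologicalSpace carrier]
  [order : PartialOrder carrier]
  [compact : CompactSpace carrier]
  [priestley : PriestleySpace carrier]

attribute [instance] Pries.top Pries.order Pries.compact Pries.priestley

/-- Objects of the category of Esakia spaces. -/
structure Esa : Type (u + 1) where
  carrier : Type u
  [top : TopologicalSpace carrier]
  [order : PartialOrder carrier]
  [esakia : EsakiaSpace carrier]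

attribute [instance] Esa.top Esa.order Esa.esakia

/-- Priestley spaces with continuous monotone maps. -/
instance : Category.{u} Pries.{u} where
  Hom X Y := X.carrier →Co Y.carrier
  id X := ContinuousOrderHom.id X.carrier
  comp f g := ContinuousOrderHom.comp g f

/-- Esakia spaces with continuous p-morphisms. -/
instance : Category.{u} Esa.{u} where
  Hom X Y := EsakiaHom X.carrier Y.carrier
  id X := EsakiaHom.id X.carrier
  comp f g := EsakiaHom.comp g f

/-- The underlying function of a morphism of Priestley spaces. -/
def Pries.fn {X Y : Pries.{u}} (f : X ⟶ Y) : X.carrier → Y.carrier :=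
  ContinuousOrderHom.toOrderHom f

/-- The underlying function of a morphism of Esakia spaces. -/
def Esa.fn {X Y : Esa.{u}} (f : X ⟶ Y) : X.carrier → Y.carrier :=
  (EsakiaHom.toContinuousOrderHom f).toOrderHom

/-- The (non-full) inclusion of Esakia spaces into Priestley spaces. -/
def esaToPries : Esa.{u} ⥤ Pries.{u} where
  obj X := { carrier := X.carrier }
  map f := EsakiaHom.toContinuousOrderHom f

/-! ## Relatively open maps and the hyperspace of rooted, closed, relatively open subsets -/

/-- `W` is the relative pseudocomplement `A → B` in the lattice of clopen upsets of `X`: the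
largest clopen upset `C` with `C ∩ A ⊆ B`. -/
def IsRelPseudocomplement {X : Type u} [TopologicalSpace X] [PartialOrder X]
    (A B W : Set X) : Prop :=
  IsGreatest {C : Set X | IsClopen C ∧ IsUpperSet C ∧ C ∩ A ⊆ B} W

/-- `f` is open relative to `g`: the preimage map of `f` preserves the relative pseudocomplements
of the form `g ⁻¹' U → g ⁻¹' V` for clopen upsets `U`, `V`. -/
def IsRelOpen {X Y Z : Type u} [TopologicalSpace X] [PartialOrder X]
    [TopologicalSpace Y] [PartialOrder Y] [TopologicalSpace Z] [PartialOrder Z]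
    (f : X → Y) (g : Y → Z) : Prop :=
  ∀ U V : Set Z, IsClopen U → IsUpperSet U → IsClopen V → IsUpperSet V →
    ∀ W : Set Y, IsRelPseudocomplement (g ⁻¹' U) (g ⁻¹' V) W →
      IsRelPseudocomplement (f ⁻¹' (g ⁻¹' U)) (f ⁻¹' (g ⁻¹' V)) (f ⁻¹' W)

/-- The set of closed, rooted, `g`-open subsets of `X`. A subset is rooted if it has a least
element, and `g`-open if its inclusion into `X` is open relative to `g`. -/
def RootedOpens {X Y : Type u} [TopologicalSpace X] [PartialOrder X]
    [TopologicalSpace Y] [PartialOrder Y] (g : X → Y) : Type u :=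
  {C : Set X // IsClosed C ∧ (∃ r, IsLeast C r) ∧ IsRelOpen (Subtype.val : C → X) g}

namespace RootedOpens

variable {X Y : Type u} [TopologicalSpace X] [PartialOrder X]
  [TopologicalSpace Y] [PartialOrder Y] {g : X → Y}

/-- The underlying subset of `X`. -/
def toSet (C : RootedOpens g) : Set X := C.1

/-- The Vietoris topology. -/
instance : TopologicalSpace (RootedOpens g) :=
  (TopologicalSpace.vietoris X).induced toSet

/-- Reverse inclusion. -/
instance : PartialOrder (RootedOpens g) where
  le C D := D.toSet ⊆ C.toSet
  le_refl _ := subset_rfl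
  le_trans _ _ _ h k := k.trans h
  le_antisymm _ _ h k := Subtype.ext (Set.Subset.antisymm k h)

/-- The root map. -/
noncomputable def root (C : RootedOpens g) : X := C.2.2.1.choose

end RootedOpens

/-! ## The Vietoris complex and its limit -/

/-- A map between two ordered topological spaces. -/
structure OrderedSpaceMap : Type (u + 1) where
  dom : Type u
  cod : Type u
  [domTop : TopologicalSpace dom]
  [domOrder : PartialOrder dom]
  [codTop : TopologicalSpace cod]
  [codOrder : PartialOrder cod]
  toFun : dom → cod

attribute [instance] OrderedSpaceMap.domTop OrderedSpaceMap.domOrder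
  OrderedSpaceMap.codTop OrderedSpaceMap.codOrder

/-- One step of the complex: from `g : X → Y` to the root map `RootedOpens g → X`. -/
noncomputable def OrderedSpaceMap.next (g : OrderedSpaceMap.{u}) : OrderedSpaceMap.{u} where
  dom := RootedOpens g.toFun
  cod := g.dom
  toFun := RootedOpens.root

section Complex

variable (X : Type u) [TopologicalSpace X] [PartialOrder X]

/-- The sequence of structure maps, starting from the map of `X` to the one-point space. -/
noncomputable def complexMap : ℕ → OrderedSpaceMap.{u}
  | 0 => { dom := X, cod := PUnit.{u + 1}, toFun := fun _ => PUnit.unit }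
  | n + 1 => (complexMap n).next

/-- The `n`-th space of the Vietoris complex over `X`. -/
abbrev Stage (n : ℕ) : Type u := (complexMap X n).dom

/-- The root map from stage `n + 1` to stage `n`. -/
noncomputable def stageRoot (n : ℕ) : Stage X (n + 1) → Stage X n :=
  fun C => RootedOpens.root (g := (complexMap X n).toFun) C

/-- A point of stage `n + 1`, as a subset of stage `n`. -/
def stageSet (n : ℕ) : Stage X (n + 1) → Set (Stage X n) :=
  fun C => RootedOpens.toSet (g := (complexMap X n).toFun) C

/-- The inverse limit of the Vietoris complex: sequences compatible with the root maps, with the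
topology and the order inherited from the product. -/
def VG : Type u := {x : ∀ n, Stage X n // ∀ n, stageRoot X n (x (n + 1)) = x n}

instance : TopologicalSpace (VG X) :=
  inferInstanceAs (TopologicalSpace {x : ∀ n, Stage X n // ∀ n, stageRoot X n (x (n + 1)) = x n})

instance : PartialOrder (VG X) :=
  inferInstanceAs (PartialOrder {x : ∀ n, Stage X n // ∀ n, stageRoot X n (x (n + 1)) = x n})

variable {X}

/-- The `n`-th projection. -/
def VG.proj (n : ℕ) (x : VG X) : Stage X n := x.1 n

/-- The projection onto `X`, which is stage `0`. -/
def VG.base (x : VG X) : X := x.proj 0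

end Complex

/-- The functor `V_G`. Its action on objects makes sense once every limit of a Vietoris complex is
an Esakia space, and it sends `p` to the unique continuous p-morphism commuting with `p` and the
projections to the base. -/
noncomputable def functorVG
    (hE : ∀ X : Pries.{u}, EsakiaSpace (VG X.carrier))
    (hL : ∀ (X Y : Pries.{u}) (p : X.carrier →Co Y.carrier),
      ∃! q : EsakiaHom (VG X.carrier) (VG Y.carrier), ∀ x, (q x).base = p x.base) :
    Pries.{u} ⥤ Esa.{u} where
  obj X := { carrier := VG X.carrier, esakia := hE X }
  map {X Y} p := (hL X Y p).choose
  map_id X := ((hL X X (ContinuousOrderHom.id _)).choose_spec.2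
    (EsakiaHom.id _) (fun _ => rfl)).symm
  map_comp {X Y Z} p q := ((hL X Z (ContinuousOrderHom.comp q p)).choose_spec.2
    (EsakiaHom.comp (hL Y Z q).choose (hL X Y p).choose) (fun x =>
      ((hL Y Z q).choose_spec.1 _).trans (congrArg (Pries.fn q) ((hL X Y p).choose_spec.1 x)))).symm

end GhilardiComplex

/-!
The limit `VG X` of the Vietoris complex is the cofree Esakia space over the Priestley space `X`.

In a Priestley space a relative pseudocomplement `A → B` of clopen upsets can only be the complement
of `↓(A \ B)`, and it exists exactly when this downset is clopen (`isRelPseudocomplement_iff`).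
If all `g ⁻¹' U → g ⁻¹' V` exist, compactness turns relative openness of a closed set `C` into a
lifting property: for `x ∈ C` and `y ≥ x` there is `s ∈ C` with `s ≥ x` and `g s = g y`
(`isRelOpen_subtypeVal_iff`). Two consequences drive everything else. The hyperspace
`RootedOpens g` is again a compact Priestley space (`RootedOpens.compactSpace`), and its root map has
the same existence property, because `↓ root ⁻¹' (U \ V)` consists of the sets meeting `U \ V`
(`RootedOpens.isStageMap_root`); so the construction can be iterated.

In the limit, the set `x (n + 1)` consists exactly of the `n`-th coordinates of the points above `x`
(`VG.exists_ge_proj_eq`). A clopen set is pulled back from an open set `O` of some stage `n`, so its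
downset consists of the `x` for which `x (n + 1)` meets `O`, which is an open condition
(`VG.esakiaSpace`). The same description of `x (n + 1)` shows that a continuous p-morphism `q` into
`VG X` satisfies `q_{n+1} z = q_n '' ↑z`, and is therefore determined by its first coordinate
(`stageSet_proj_map`, `esakiaHom_ext_base`). Conversely this recursion, started at a continuous
monotone map from an Esakia space to `X`, yields a continuous p-morphism
(`exists_esakiaHom_base_eq`). The universal property gives the functor and the adjunction, and the
recursion for the lift of the identity is the formula for the unit.
-/

namespace GhilardiComplex

open Set Filter Topology

/-! ### Priestley spaces -/

section Priestley

variable {X Y : Type u} [TopologicalSpace X] [PartialOrder X]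
  [TopologicalSpace Y] [PartialOrder Y]

instance PriestleySpace.orderClosedTopology [PriestleySpace X] : OrderClosedTopology X where
  isClosed_le' := by
    rw [← isOpen_compl_iff, isOpen_iff_mem_nhds]
    rintro ⟨x, y⟩ h
    obtain ⟨U, hU, hup, hx, hy⟩ := exists_isClopen_upper_of_not_le (h : ¬ x ≤ y)
    filter_upwards [prod_mem_nhds (hU.isOpen.mem_nhds hx) (hU.compl.isOpen.mem_nhds hy)]
      with p hp hle
    exact hp.2 (hup hle hp.1)

instance PriestleySpace.subtype [PriestleySpace X] (C : Set X) : PriestleySpace C where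
  priestley {x y} h := by
    obtain ⟨U, hU, hup, hx, hy⟩ := exists_isClopen_upper_of_not_le (x := x.1) (y := y.1) h
    exact ⟨Subtype.val ⁻¹' U, hU.preimage continuous_subtype_val, fun a b hab ha => hup hab ha,
      hx, hy⟩

instance : PriestleySpace PUnit.{u + 1} where
  priestley h := (h le_rfl).elim

theorem isClosed_lowerClosure [CompactSpace X] [PriestleySpace X] {S : Set X} (hS : IsClosed S) :
    IsClosed (lowerClosure S : Set X) := by
  have h : (lowerClosure S : Set X) = Prod.fst '' {p : X × X | p.1 ≤ p.2 ∧ p.2 ∈ S} := by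
    ext x
    simp only [SetLike.mem_coe, mem_lowerClosure, mem_image, Prod.exists, mem_ofPred_eq]
    exact ⟨fun ⟨a, ha, hx⟩ => ⟨x, a, ⟨hx, ha⟩, rfl⟩, fun ⟨_, a, ⟨hx, ha⟩, e⟩ => ⟨a, ha, e ▸ hx⟩⟩
  rw [h]
  exact isClosedMap_fst_of_compactSpace _
    ((isClosed_le continuous_fst continuous_snd).inter (hS.preimage continuous_snd))

/-- In a Priestley space the differences of two clopen upsets form a base: the members containing
a given point are compact and directed, with the point as their only common element. -/
theorem exists_diff_subset_of_isOpen [CompactSpace X] [PriestleySpace X] {O : Set X}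
    (hO : IsOpen O) {x : X} (hx : x ∈ O) :
    ∃ U V : Set X, IsClopen U ∧ IsUpperSet U ∧ IsClopen V ∧ IsUpperSet V ∧
      x ∈ U \ V ∧ U \ V ⊆ O := by
  let ι := {p : Set X × Set X // IsClopen p.1 ∧ IsUpperSet p.1 ∧ IsClopen p.2 ∧ IsUpperSet p.2 ∧
    x ∈ p.1 \ p.2}
  have : Nonempty ι := ⟨⟨(univ, ∅), isClopen_univ, isUpperSet_univ, isClopen_empty,
    isUpperSet_empty, mem_univ _, notMem_empty _⟩⟩
  have hcl : ∀ i : ι, IsClosed (i.1.1 \ i.1.2) := fun i => (i.2.1.diff i.2.2.2.1).isClosed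
  obtain ⟨i, hi⟩ := exists_subset_nhds_of_isCompact' (V := fun i : ι => i.1.1 \ i.1.2) (U := O)
    (by
      rintro ⟨⟨U, V⟩, hU, hU', hV, hV', hxU, hxV⟩ ⟨⟨U₂, V₂⟩, hU₂, hU₂', hV₂, hV₂', hxU₂, hxV₂⟩
      refine ⟨⟨(U ∩ U₂, V ∪ V₂), hU.inter hU₂, hU'.inter hU₂', hV.union hV₂, hV'.union hV₂',
        ⟨hxU, hxU₂⟩, fun h => h.elim hxV hxV₂⟩, ?_, ?_⟩
      · exact fun a ha => ⟨ha.1.1, fun h => ha.2 (Or.inl h)⟩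
      · exact fun a ha => ⟨ha.1.2, fun h => ha.2 (Or.inr h)⟩)
    (fun i => (hcl i).isCompact) hcl (by
      intro y hy
      have hyx : y = x := by
        by_contra hne
        rw [mem_iInter] at hy
        by_cases hle : x ≤ y
        · have hle' : ¬ y ≤ x := fun h => hne (le_antisymm h hle)
          obtain ⟨V, hV, hV', hyV, hxV⟩ := exists_isClopen_upper_of_not_le hle'
          exact (hy ⟨(univ, V), isClopen_univ, isUpperSet_univ, hV, hV', mem_univ _, hxV⟩).2 hyV
        · obtain ⟨U, hU, hU', hxU, hyU⟩ := exists_isClopen_upper_of_not_le hle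
          exact hyU (hy ⟨(U, ∅), hU, hU', isClopen_empty, isUpperSet_empty, hxU,
            notMem_empty _⟩).1
      exact hyx ▸ hO.mem_nhds hx)
  exact ⟨i.1.1, i.1.2, i.2.1, i.2.2.1, i.2.2.2.1, i.2.2.2.2.1, i.2.2.2.2.2, hi⟩

/-- A map to a Priestley space is continuous as soon as preimages of clopen upsets are clopen. -/
theorem continuous_of_isClopen_preimage {Z : Type*} [TopologicalSpace Z] [CompactSpace X]
    [PriestleySpace X] {f : Z → X}
    (h : ∀ U : Set X, IsClopen U → IsUpperSet U → IsClopen (f ⁻¹' U)) : Continuous f := by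
  rw [continuous_iff_continuousAt]
  intro z O hO
  obtain ⟨O', hsub, hO', hz⟩ := mem_nhds_iff.1 hO
  obtain ⟨U, V, hU, hU', hV, hV', hzUV, hUV⟩ := exists_diff_subset_of_isOpen hO' hz
  exact mem_of_superset (((h U hU hU').diff (h V hV hV')).isOpen.mem_nhds hzUV)
    fun w hw => hsub (hUV hw)

/-- A compactness principle: a closed set contains a point above `x` in the fibre of `g` over `y`
if it contains approximate such points. -/
theorem exists_ge_of_forall_isClopen [CompactSpace X] [PriestleySpace X] [CompactSpace Y]
    [PriestleySpace Y] {g : X → Y} (hg : Continuous g) {K : Set X} (hK : IsClosed K) {x : X}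
    {y : Y}
    (h : ∀ W : Set X, IsClopen W → IsUpperSet W → x ∈ W → ∀ U V : Set Y, IsClopen U →
      IsUpperSet U → IsClopen V → IsUpperSet V → y ∈ U \ V → ∃ s ∈ K, s ∈ W ∧ g s ∈ U \ V) :
    ∃ s ∈ K, x ≤ s ∧ g s = y := by
  let ι := {p : Set X × Set Y × Set Y // (IsClopen p.1 ∧ IsUpperSet p.1 ∧ x ∈ p.1) ∧
    (IsClopen p.2.1 ∧ IsUpperSet p.2.1 ∧ IsClopen p.2.2 ∧ IsUpperSet p.2.2 ∧ y ∈ p.2.1 \ p.2.2)}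
  have : Nonempty ι := ⟨⟨(univ, univ, ∅), ⟨isClopen_univ, isUpperSet_univ, mem_univ _⟩,
    isClopen_univ, isUpperSet_univ, isClopen_empty, isUpperSet_empty, mem_univ _,
    notMem_empty _⟩⟩
  have hcl : ∀ i : ι, IsClosed (K ∩ (i.1.1 ∩ g ⁻¹' (i.1.2.1 \ i.1.2.2))) := fun i =>
    hK.inter (i.2.1.1.isClosed.inter ((i.2.2.1.diff i.2.2.2.2.1).isClosed.preimage hg))
  obtain ⟨s, hs⟩ := IsCompact.nonempty_iInter_of_directed_nonempty_isCompact_isClosed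
    (fun i : ι => K ∩ (i.1.1 ∩ g ⁻¹' (i.1.2.1 \ i.1.2.2)))
    (by
      rintro ⟨⟨W, U, V⟩, ⟨hW, hW', hxW⟩, hU, hU', hV, hV', hxU, hxV⟩
        ⟨⟨W₂, U₂, V₂⟩, ⟨hW₂, hW₂', hxW₂⟩, hU₂, hU₂', hV₂, hV₂', hxU₂, hxV₂⟩
      refine ⟨⟨(W ∩ W₂, U ∩ U₂, V ∪ V₂), ⟨hW.inter hW₂, hW'.inter hW₂', hxW, hxW₂⟩,
        hU.inter hU₂, hU'.inter hU₂', hV.union hV₂, hV'.union hV₂',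
        ⟨hxU, hxU₂⟩, fun h => h.elim hxV hxV₂⟩, ?_, ?_⟩
      · exact fun a ha => ⟨ha.1, ha.2.1.1, ha.2.2.1.1, fun h => ha.2.2.2 (Or.inl h)⟩
      · exact fun a ha => ⟨ha.1, ha.2.1.2, ha.2.2.1.2, fun h => ha.2.2.2 (Or.inr h)⟩)
    (by
      rintro ⟨⟨W, U, V⟩, ⟨hW, hW', hxW⟩, hU, hU', hV, hV', hxUV⟩
      obtain ⟨s, hsK, hsW, hs⟩ := h W hW hW' hxW U V hU hU' hV hV' hxUV
      exact ⟨s, hsK, hsW, hs⟩)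
    (fun i => (hcl i).isCompact) hcl
  rw [mem_iInter] at hs
  refine ⟨s, (hs (Classical.arbitrary ι)).1, ?_, ?_⟩
  · by_contra hle
    obtain ⟨W, hW, hW', hxW, hsW⟩ := exists_isClopen_upper_of_not_le hle
    exact hsW (hs ⟨(W, univ, ∅), ⟨hW, hW', hxW⟩, isClopen_univ, isUpperSet_univ, isClopen_empty,
      isUpperSet_empty, mem_univ _, notMem_empty _⟩).2.1
  · by_contra hne
    obtain ⟨U, V, hU, hU', hV, hV', hyUV, hUV⟩ :=
      exists_diff_subset_of_isOpen (isOpen_compl_singleton (x := g s)) (Ne.symm hne)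
    exact hUV (hs ⟨(univ, U, V), ⟨isClopen_univ, isUpperSet_univ, mem_univ _⟩, hU, hU', hV, hV',
      hyUV⟩).2.2 rfl

end Priestley

/-! ### Relative pseudocomplements and relatively open subsets -/

section RelOpen

variable {X Y : Type u} [TopologicalSpace X] [PartialOrder X]
  [TopologicalSpace Y] [PartialOrder Y]

/-- The complement of `↓(A \ B)` is the largest upset `C` with `C ∩ A ⊆ B`, and it is open, hence
a union of clopen upsets; so a largest clopen upset of this kind must be equal to it. -/
theorem isRelPseudocomplement_iff [CompactSpace X] [PriestleySpace X] {A B W : Set X}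
    (hA : IsClopen A) (hB : IsClopen B) :
    IsRelPseudocomplement A B W ↔ IsClopen W ∧ W = (lowerClosure (A \ B) : Set X)ᶜ := by
  have hmax : ∀ C : Set X, IsUpperSet C → C ∩ A ⊆ B → C ⊆ (lowerClosure (A \ B) : Set X)ᶜ := by
    rintro C hC hCA x hx ⟨a, ha, hxa⟩
    exact ha.2 (hCA ⟨hC hxa hx, ha.1⟩)
  have hsub : (lowerClosure (A \ B) : Set X)ᶜ ∩ A ⊆ B := by
    rintro x ⟨hx, hxA⟩
    by_contra hxB
    exact hx (subset_lowerClosure ⟨hxA, hxB⟩)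
  have hupper : IsUpperSet (lowerClosure (A \ B) : Set X)ᶜ := (lowerClosure (A \ B)).lower.compl
  constructor
  · rintro ⟨⟨hW, hW', hWA⟩, hgreat⟩
    refine ⟨hW, (hmax W hW' hWA).antisymm fun x hx => ?_⟩
    -- If every clopen upset around `x` meets `↓(A \ B)`, then by compactness so does `↑x`. Hence
    -- some clopen upset around `x` misses it, and this upset is contained in `W`. As only the order
    -- on `X` matters, the compactness principle is used with the map to a point.
    have hcl : IsClosed (lowerClosure (A \ B) : Set X) :=
      isClosed_lowerClosure (hA.diff hB).isClosed
    by_contra hxW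
    obtain ⟨s, hs, hxs, -⟩ := exists_ge_of_forall_isClopen (g := fun _ : X => PUnit.unit.{u+1})
      continuous_const hcl (x := x) (y := PUnit.unit) (by
        intro C hC hC' hxC U V _ _ _ _ hUV
        by_contra hno
        push Not at hno
        refine hxW (hgreat ⟨hC, hC', ?_⟩ hxC)
        rintro a ⟨haC, haA⟩
        by_contra haB
        exact hno a (subset_lowerClosure ⟨haA, haB⟩) haC hUV)
    exact hupper hxs hx hs
  · rintro ⟨hW, rfl⟩
    exact ⟨⟨hW, hupper, hsub⟩, fun C hC => hmax C hC.2.1 hC.2.2⟩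

/-- The properties of `g` from which the construction `RootedOpens g` can be iterated: `g` is
continuous and monotone, and all relative pseudocomplements `g ⁻¹' U → g ⁻¹' V` of clopen upsets
exist, that is, `↓(g ⁻¹' (U \ V))` is clopen. -/
structure IsStageMap (g : X → Y) : Prop where
  continuous : Continuous g
  monotone : Monotone g
  isClopen_lowerClosure : ∀ U V : Set Y, IsClopen U → IsUpperSet U → IsClopen V → IsUpperSet V →
    IsClopen (lowerClosure (g ⁻¹' U \ g ⁻¹' V) : Set X)

theorem isStageMap_const (c : Y) : IsStageMap (fun _ : X => c) where
  continuous := continuous_const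
  monotone := monotone_const
  isClopen_lowerClosure U V _ _ _ _ := by
    by_cases h : c ∈ U \ V
    · have : (fun _ : X => c) ⁻¹' U \ (fun _ : X => c) ⁻¹' V = univ := eq_univ_of_forall fun _ => h
      rw [this, lowerClosure_univ]
      exact isClopen_univ
    · have : (fun _ : X => c) ⁻¹' U \ (fun _ : X => c) ⁻¹' V = ∅ :=
        eq_empty_of_forall_notMem fun _ => h
      rw [this, lowerClosure_empty]
      exact isClopen_empty

/-- For closed subsets, relative openness is a pointwise lifting property. -/
theorem isRelOpen_subtypeVal_iff [CompactSpace X] [PriestleySpace X] [CompactSpace Y]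
    [PriestleySpace Y] {g : X → Y}
    (hg : IsStageMap g) {C : Set X} (hC : IsClosed C) :
    IsRelOpen (Subtype.val : C → X) g ↔
      ∀ x ∈ C, ∀ y, x ≤ y → ∃ s ∈ C, x ≤ s ∧ g s = g y := by
  have : CompactSpace C := isCompact_iff_compactSpace.1 hC.isCompact
  have hval : Continuous (Subtype.val : C → X) := continuous_subtype_val
  constructor
  · intro h x hx y hxy
    refine exists_ge_of_forall_isClopen hg.continuous hC fun W _ hW' hxW U V hU hU' hV hV' hUV => ?_
    have hUc := hU.preimage hg.continuous
    have hVc := hV.preimage hg.continuous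
    have h1 := h U V hU hU' hV hV' _ ((isRelPseudocomplement_iff hUc hVc).2
      ⟨(hg.isClopen_lowerClosure U V hU hU' hV hV').compl, rfl⟩)
    have h2 := ((isRelPseudocomplement_iff (hUc.preimage hval) (hVc.preimage hval)).1 h1).2
    have h3 : (⟨x, hx⟩ : C) ∉ Subtype.val ⁻¹' (lowerClosure (g ⁻¹' U \ g ⁻¹' V) : Set X)ᶜ :=
      fun hn => hn ⟨y, hUV, hxy⟩
    rw [h2] at h3
    obtain ⟨s, hs, hxs⟩ := not_not.1 h3
    exact ⟨s, s.2, hW' hxs hxW, hs⟩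
  · intro h U V hU hU' hV hV' W hW
    have hUc := hU.preimage hg.continuous
    have hVc := hV.preimage hg.continuous
    obtain ⟨hWc, hWe⟩ := (isRelPseudocomplement_iff hUc hVc).1 hW
    refine (isRelPseudocomplement_iff (hUc.preimage hval) (hVc.preimage hval)).2
      ⟨hWc.preimage hval, ?_⟩
    rw [hWe, preimage_compl, compl_inj_iff]
    ext ⟨x, hx⟩
    constructor
    · rintro ⟨y, hy, hxy⟩
      obtain ⟨s, hs, hxs, hsy⟩ := h x hx y hxy
      exact ⟨⟨s, hs⟩, show g s ∈ U \ V from hsy ▸ hy, hxs⟩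
    · rintro ⟨s, hs, hxs⟩
      exact ⟨s, hs, hxs⟩

end RelOpen

/-! ### The hyperspace of rooted, closed, relatively open subsets -/

namespace RootedOpens

variable {X Y : Type u} [TopologicalSpace X] [PartialOrder X]
  [TopologicalSpace Y] [PartialOrder Y] {g : X → Y}

theorem isClosed_toSet (C : RootedOpens g) : IsClosed C.toSet := C.2.1

theorem toSet_injective : Function.Injective (toSet : RootedOpens g → Set X) :=
  Subtype.val_injective

theorem isLeast_root (C : RootedOpens g) : IsLeast C.toSet C.root := C.2.2.1.choose_spec

theorem root_eq {C : RootedOpens g} {r : X} (h : IsLeast C.toSet r) : C.root = r :=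
  C.isLeast_root.unique h

theorem monotone_root : Monotone (root : RootedOpens g → X) := fun _ D h =>
  (isLeast_root _).2 (h D.isLeast_root.1)

theorem isOpen_setOf_subset {U : Set X} (hU : IsOpen U) :
    IsOpen {C : RootedOpens g | C.toSet ⊆ U} :=
  letI := TopologicalSpace.vietoris X
  isOpen_induced_iff.2 ⟨_, hU.powerset_vietoris, rfl⟩

theorem isOpen_setOf_inter_nonempty {U : Set X} (hU : IsOpen U) :
    IsOpen {C : RootedOpens g | (C.toSet ∩ U).Nonempty} :=
  letI := TopologicalSpace.vietoris X
  isOpen_induced_iff.2 ⟨_, TopologicalSpace.vietoris.isOpen_inter_nonempty_of_isOpen hU, rfl⟩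

theorem isClopen_setOf_subset {U : Set X} (hU : IsClopen U) :
    IsClopen {C : RootedOpens g | C.toSet ⊆ U} := by
  refine ⟨?_, isOpen_setOf_subset hU.isOpen⟩
  convert (isOpen_setOf_inter_nonempty (g := g) hU.compl.isOpen).isClosed_compl using 1
  ext C
  simp [Set.not_nonempty_iff_eq_empty, ← disjoint_iff_inter_eq_empty,
    disjoint_compl_right_iff_subset]

theorem isClopen_setOf_inter_nonempty {U : Set X} (hU : IsClopen U) :
    IsClopen {C : RootedOpens g | (C.toSet ∩ U).Nonempty} := by
  refine ⟨?_, isOpen_setOf_inter_nonempty hU.isOpen⟩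
  convert (isOpen_setOf_subset (g := g) hU.compl.isOpen).isClosed_compl using 1
  ext C
  simp [subset_compl_iff_disjoint_right, ← not_disjoint_iff_nonempty_inter]

theorem continuous_of_isOpen_preimage {Z : Type*} [TopologicalSpace Z] {f : Z → RootedOpens g}
    (h₁ : ∀ U : Set X, IsOpen U → IsOpen {z | (f z).toSet ⊆ U})
    (h₂ : ∀ U : Set X, IsOpen U → IsOpen {z | ((f z).toSet ∩ U).Nonempty}) : Continuous f := by
  let _ := TopologicalSpace.vietoris X
  rw [continuous_induced_rng, continuous_generateFrom_iff]
  rintro _ (⟨U, hU, rfl⟩ | ⟨U, hU, rfl⟩)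
  · exact h₁ U hU
  · exact h₂ U hU

theorem le_nhds_of_mem {F : Filter (RootedOpens g)} {C : RootedOpens g}
    (h₁ : ∀ U : Set X, IsOpen U → C.toSet ⊆ U → ∀ᶠ D in F, D.toSet ⊆ U)
    (h₂ : ∀ U : Set X, IsOpen U → (C.toSet ∩ U).Nonempty → ∀ᶠ D in F, (D.toSet ∩ U).Nonempty) :
    F ≤ 𝓝 C := by
  let _ := TopologicalSpace.vietoris X
  rw [nhds_induced, ← tendsto_iff_comap, TopologicalSpace.tendsto_nhds_generateFrom_iff]
  rintro _ (⟨U, hU, rfl⟩ | ⟨U, hU, rfl⟩) hC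
  · exact h₁ U hU hC
  · exact h₂ U hU hC

variable [CompactSpace X] [PriestleySpace X]

theorem continuous_root : Continuous (root : RootedOpens g → X) := by
  refine continuous_of_isClopen_preimage fun U hU hU' => ?_
  convert isClopen_setOf_subset (g := g) hU using 1
  ext C
  exact ⟨fun h _ hx => hU' (C.isLeast_root.2 hx) h, fun h => h C.isLeast_root.1⟩

instance priestleySpace : PriestleySpace (RootedOpens g) where
  priestley {C D} h := by
    obtain ⟨x, hxD, hxC⟩ := not_subset.1 (h : ¬ D.toSet ⊆ C.toSet)
    obtain ⟨U, hU, hxU, hUC⟩ := compact_exists_isClopen_in_isOpen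
      C.isClosed_toSet.isOpen_compl hxC
    refine ⟨{E | E.toSet ⊆ Uᶜ}, isClopen_setOf_subset hU.compl,
      fun E E' hE hEU => Subset.trans hE hEU, fun y hy hyU => hUC hyU hy, fun hD => hD hxD hxU⟩

variable [CompactSpace Y] [PriestleySpace Y]

theorem exists_of_mem (hg : IsStageMap g) (C : RootedOpens g) {x : X} (hx : x ∈ C.toSet) {y : X}
    (hxy : x ≤ y) : ∃ s ∈ C.toSet, x ≤ s ∧ g s = g y :=
  (isRelOpen_subtypeVal_iff hg C.2.1).1 C.2.2.2 x hx y hxy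

theorem exists_toSet_eq (hg : IsStageMap g) {K : Set X} (hK : IsClosed K) {r : X}
    (hr : IsLeast K r) (h : ∀ x ∈ K, ∀ y, x ≤ y → ∃ s ∈ K, x ≤ s ∧ g s = g y) :
    ∃ C : RootedOpens g, C.toSet = K :=
  ⟨⟨K, hK, ⟨r, hr⟩, (isRelOpen_subtypeVal_iff hg hK).2 h⟩, rfl⟩

/-- Every point `x` of `C` is the root of a member of the hyperspace contained in `C`,
namely `C ∩ ↑x`. -/
theorem exists_ge_root_eq (hg : IsStageMap g) (C : RootedOpens g) {x : X} (hx : x ∈ C.toSet) :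
    ∃ D : RootedOpens g, C ≤ D ∧ D.root = x := by
  have hr : IsLeast (C.toSet ∩ Ici x) x := ⟨⟨hx, le_rfl⟩, fun _ h => h.2⟩
  obtain ⟨D, hD⟩ := exists_toSet_eq hg (C.isClosed_toSet.inter isClosed_Ici) hr
    (fun a ha y hay => by
      obtain ⟨s, hs, has, hsy⟩ := C.exists_of_mem hg ha.1 hay
      exact ⟨s, ⟨hs, le_trans ha.2 has⟩, has, hsy⟩)
  exact ⟨D, hD.trans_subset inter_subset_left, root_eq (hD ▸ hr)⟩

/-- An ultrafilter of members of the hyperspace converges to the set of all `x` each of whose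
neighbourhoods meets almost all members. The existence of relative pseudocomplements makes this
limit relatively open. -/
theorem compactSpace (hg : IsStageMap g) : CompactSpace (RootedOpens g) := by
  refine ⟨isCompact_iff_ultrafilter_le_nhds.2 fun F _ => ?_⟩
  let K : Set X := {x | ∀ U : Set X, IsOpen U → x ∈ U → ∀ᶠ D in (F : Filter (RootedOpens g)),
    (D.toSet ∩ U).Nonempty}
  have hKopen : ∀ x ∉ K, ∃ U : Set X, IsOpen U ∧ x ∈ U ∧
      ∀ᶠ D in (F : Filter (RootedOpens g)), ¬ (D.toSet ∩ U).Nonempty := by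
    intro x hx
    by_contra hno
    exact hx fun U hU hxU => by_contra fun h => hno ⟨U, hU, hxU, Ultrafilter.eventually_not.2 h⟩
  have hK : IsClosed K := by
    rw [← isOpen_compl_iff, isOpen_iff_forall_mem_open]
    intro x hx
    obtain ⟨U, hU, hxU, hF⟩ := hKopen x hx
    refine ⟨U, fun y hyU hy => ?_, hU, hxU⟩
    obtain ⟨D, h1, h2⟩ := ((hy U hU hyU).and hF).exists
    exact h2 h1
  have hKU : ∀ U : Set X, IsOpen U → K ⊆ U →
      ∀ᶠ D in (F : Filter (RootedOpens g)), D.toSet ⊆ U := by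
    intro U hU hKU
    -- The compact set `Uᶜ` is covered by finitely many open sets, each missed by almost all members.
    have key : ∀ᶠ D in (F : Filter (RootedOpens g)), ¬ (D.toSet ∩ Uᶜ).Nonempty := by
      refine hU.isClosed_compl.isCompact.induction_on
        (p := fun S => ∀ᶠ D in (F : Filter (RootedOpens g)), ¬ (D.toSet ∩ S).Nonempty)
        (Eventually.of_forall fun D => by simp) ?_ ?_ ?_
      · exact fun S T hST hT => hT.mono fun D hD h => hD (h.mono (inter_subset_inter_right _ hST))
      · intro S T hS hT
        filter_upwards [hS, hT] with D h1 h2 h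
        rw [inter_union_distrib_left, union_nonempty] at h
        exact h.elim h1 h2
      · intro x hx
        obtain ⟨V, hV, hxV, hF⟩ := hKopen x fun h => hx (hKU h)
        exact ⟨V, mem_nhdsWithin_of_mem_nhds (hV.mem_nhds hxV), hF⟩
    filter_upwards [key] with D hD x hx
    by_contra hxU
    exact hD ⟨x, hx, hxU⟩
  obtain ⟨r, -, hr⟩ := isCompact_univ.ultrafilter_le_nhds (F.map root) (by simp)
  have hroot : ∀ U : Set X, IsOpen U → r ∈ U →
      ∀ᶠ D in (F : Filter (RootedOpens g)), D.root ∈ U := fun U hU hrU =>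
    hr (hU.mem_nhds hrU)
  have hleast : IsLeast K r := by
    refine ⟨fun U hU hrU => (hroot U hU hrU).mono fun D hD => ⟨_, D.isLeast_root.1, hD⟩, ?_⟩
    intro x hx
    by_contra hle
    obtain ⟨U, hU, hU', hrU, hxU⟩ := exists_isClopen_upper_of_not_le hle
    obtain ⟨D, ⟨y, hyD, hyU⟩, hD⟩ :=
      ((hx Uᶜ hU.compl.isOpen hxU).and (hroot U hU.isOpen hrU)).exists
    exact hyU (hU' (D.isLeast_root.2 hyD) hD)
  obtain ⟨C, hC⟩ := exists_toSet_eq hg hK hleast (by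
    intro x hx y hxy
    refine exists_ge_of_forall_isClopen hg.continuous hK
      fun W hW hW' hxW U V hU hU' hV hV' hUV => ?_
    by_contra! hno
    have hcl : IsClopen (W ∩ g ⁻¹' (U \ V)) := hW.inter ((hU.diff hV).preimage hg.continuous)
    -- Near `x`, every point lies in `↓ g ⁻¹' (U \ V)`, so that almost all members meet the clopen
    -- set `W ∩ g ⁻¹' (U \ V)`.
    obtain ⟨D, ⟨d, hdD, ⟨y', hy', hdy'⟩, hdW⟩, hD⟩ := ((hx _
      ((hg.isClopen_lowerClosure U V hU hU' hV hV').isOpen.inter hW.isOpen)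
      ⟨⟨y, hUV, hxy⟩, hxW⟩).and (hKU _ hcl.compl.isOpen fun s hs h => hno s hs h.1 h.2)).exists
    obtain ⟨s, hsD, hds, hsy⟩ := D.exists_of_mem hg hdD hdy'
    exact hD hsD ⟨hW' hds hdW, show g s ∈ U \ V from hsy ▸ hy'⟩)
  refine ⟨C, mem_univ _, le_nhds_of_mem (hC ▸ hKU) ?_⟩
  rintro U hU ⟨x, hxC, hxU⟩
  exact (hC ▸ hxC : x ∈ K) U hU hxU

/-- The downset of `root ⁻¹' (U \ V)` consists of the sets that meet `U \ V`. -/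
theorem isStageMap_root (hg : IsStageMap g) : IsStageMap (root : RootedOpens g → X) where
  continuous := continuous_root
  monotone := monotone_root
  isClopen_lowerClosure U V hU _ hV _ := by
    convert isClopen_setOf_inter_nonempty (g := g) (hU.diff hV) using 1
    ext C
    constructor
    · rintro ⟨D, hD, hCD⟩
      exact ⟨D.root, hCD D.isLeast_root.1, hD⟩
    · rintro ⟨x, hx, hxUV⟩
      obtain ⟨D, hCD, rfl⟩ := C.exists_ge_root_eq hg hx
      exact ⟨D, hxUV, hCD⟩

end RootedOpens

/-! ### The stages of the Vietoris complex -/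

/-- The properties that every map of the Vietoris complex has. -/
structure OrderedSpaceMap.IsStage (g : OrderedSpaceMap.{u}) : Prop where
  compactSpace_dom : CompactSpace g.dom
  priestleySpace_dom : PriestleySpace g.dom
  compactSpace_cod : CompactSpace g.cod
  priestleySpace_cod : PriestleySpace g.cod
  isStageMap : IsStageMap g.toFun

theorem OrderedSpaceMap.IsStage.next {g : OrderedSpaceMap.{u}} (hg : g.IsStage) :
    g.next.IsStage := by
  obtain ⟨h₁, h₂, _, _, h⟩ := hg
  exact ⟨RootedOpens.compactSpace h, RootedOpens.priestleySpace, h₁, h₂,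
    RootedOpens.isStageMap_root (g := g.toFun) h⟩

section Stage

variable {X : Type u} [TopologicalSpace X] [PartialOrder X]

theorem isLeast_stageRoot {n : ℕ} (C : Stage X (n + 1)) :
    IsLeast (stageSet X n C) (stageRoot X n C) :=
  RootedOpens.isLeast_root (g := (complexMap X n).toFun) C

theorem stageRoot_eq {n : ℕ} {C : Stage X (n + 1)} {r : Stage X n}
    (h : IsLeast (stageSet X n C) r) : stageRoot X n C = r :=
  (isLeast_stageRoot C).unique h

theorem stage_le_iff {n : ℕ} {C D : Stage X (n + 1)} :
    C ≤ D ↔ stageSet X n D ⊆ stageSet X n C := Iff.rfl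

theorem stageSet_injective (n : ℕ) : Function.Injective (stageSet X n) :=
  RootedOpens.toSet_injective (g := (complexMap X n).toFun)

theorem monotone_stageRoot (n : ℕ) : Monotone (stageRoot X n) :=
  RootedOpens.monotone_root (g := (complexMap X n).toFun)

theorem isOpen_setOf_stageSet_inter_nonempty {n : ℕ} {U : Set (Stage X n)} (hU : IsOpen U) :
    IsOpen {C | (stageSet X n C ∩ U).Nonempty} :=
  RootedOpens.isOpen_setOf_inter_nonempty (g := (complexMap X n).toFun) hU

theorem continuous_stage_of_isOpen_preimage {Z : Type*} [TopologicalSpace Z] {n : ℕ}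
    {f : Z → Stage X (n + 1)}
    (h₁ : ∀ U : Set (Stage X n), IsOpen U → IsOpen {z | stageSet X n (f z) ⊆ U})
    (h₂ : ∀ U : Set (Stage X n), IsOpen U → IsOpen {z | (stageSet X n (f z) ∩ U).Nonempty}) :
    Continuous f :=
  RootedOpens.continuous_of_isOpen_preimage (g := (complexMap X n).toFun) h₁ h₂

variable [CompactSpace X] [PriestleySpace X]

theorem isStage_complexMap : ∀ n : ℕ, (complexMap X n).IsStage
  | 0 => ⟨‹_›, ‹_›, inferInstanceAs (CompactSpace PUnit.{u + 1}),
      inferInstanceAs (PriestleySpace PUnit.{u + 1}),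
      isStageMap_const (X := X) PUnit.unit.{u + 1}⟩
  | n + 1 => (isStage_complexMap n).next

instance (n : ℕ) : CompactSpace (Stage X n) := (isStage_complexMap n).compactSpace_dom

instance (n : ℕ) : PriestleySpace (Stage X n) := (isStage_complexMap n).priestleySpace_dom

theorem continuous_stageRoot (n : ℕ) : Continuous (stageRoot X n) :=
  RootedOpens.continuous_root (g := (complexMap X n).toFun)

theorem exists_stageSet_eq {n : ℕ} {K : Set (Stage X n)} (hK : IsClosed K) {r : Stage X n}
    (hr : IsLeast K r) (h : ∀ x ∈ K, ∀ y, x ≤ y → ∃ s ∈ K, x ≤ s ∧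
      (complexMap X n).toFun s = (complexMap X n).toFun y) :
    ∃ C : Stage X (n + 1), stageSet X n C = K := by
  obtain ⟨_, _, _, _, hg⟩ := isStage_complexMap (X := X) n
  exact RootedOpens.exists_toSet_eq hg hK hr h

/-- A member `C` of the relatively open set `S` can be enlarged inside `S` to have any given
point of `C` as its root. -/
theorem exists_mem_stageSet_stageRoot_eq {n : ℕ} {S : Stage X (n + 2)} {C : Stage X (n + 1)}
    (hC : C ∈ stageSet X (n + 1) S) {y : Stage X n} (hy : y ∈ stageSet X n C) :
    ∃ D ∈ stageSet X (n + 1) S, stageRoot X n D = y := by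
  obtain ⟨_, _, _, _, hg⟩ := isStage_complexMap (X := X) n
  have _ := RootedOpens.compactSpace hg
  obtain ⟨E, hCE, rfl⟩ := RootedOpens.exists_ge_root_eq hg C hy
  obtain ⟨D, hD, -, h⟩ :=
    RootedOpens.exists_of_mem (RootedOpens.isStageMap_root hg) S hC hCE
  exact ⟨D, hD, h⟩

end Stage

/-! ### The limit of the Vietoris complex is an Esakia space -/

/-- In an inverse sequence `F`, let `S n ⊆ F n` be sets mapped into each other, such that every
element of `S n` lifts to `S (n + 1)`. Then every element of `S n` lies on a thread through these
sets. -/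
theorem exists_thread {n : ℕ} : ∀ {F : ℕ → Type u} (r : ∀ n, F (n + 1) → F n)
    (S : ∀ n, Set (F n)), (∀ n, ∀ a ∈ S (n + 1), r n a ∈ S n) →
    (∀ n, ∀ a ∈ S n, ∃ b ∈ S (n + 1), r n b = a) → ∀ a ∈ S n,
    ∃ t : ∀ n, F n, t n = a ∧ ∀ m, t m ∈ S m ∧ r m (t (m + 1)) = t m := by
  induction n with
  | zero =>
    intro F r S _ hlift a ha
    choose b hbS hb using hlift
    let t : ∀ m, {c : F m // c ∈ S m} := fun m =>
      Nat.rec ⟨a, ha⟩ (fun m c => ⟨b m c.1 c.2, hbS m c.1 c.2⟩) m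
    exact ⟨fun m => (t m).1, rfl, fun m => ⟨(t m).2, hb m _ (t m).2⟩⟩
  | succ n ih =>
    intro F r S hS hlift a ha
    obtain ⟨t, hta, ht⟩ := ih (F := fun m => F (m + 1)) (fun m => r (m + 1)) (fun m => S (m + 1))
      (fun m => hS (m + 1)) (fun m => hlift (m + 1)) a ha
    refine ⟨fun m => Nat.casesOn m (r 0 (t 0)) t, hta, fun m => ?_⟩
    cases m with
    | zero => exact ⟨hS 0 _ (ht 0).1, rfl⟩
    | succ m => exact ht m

namespace VG

variable {X : Type u} [TopologicalSpace X] [PartialOrder X]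

theorem stageRoot_proj (x : VG X) (n : ℕ) : stageRoot X n (x.proj (n + 1)) = x.proj n := x.2 n

theorem ext_proj {x y : VG X} (h : ∀ n, x.proj n = y.proj n) : x = y := Subtype.ext (funext h)

theorem le_iff_proj {x y : VG X} : x ≤ y ↔ ∀ n, x.proj n ≤ y.proj n := Iff.rfl

theorem continuous_proj (n : ℕ) : Continuous (proj n : VG X → Stage X n) :=
  (continuous_apply n).comp (continuous_induced_dom (f := Subtype.val))

theorem continuous_of_proj {Z : Type*} [TopologicalSpace Z] {f : Z → VG X}
    (h : ∀ n, Continuous fun z => (f z).proj n) : Continuous f :=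
  continuous_induced_rng.2 (continuous_pi h)

theorem proj_mem_stageSet {x y : VG X} (h : x ≤ y) (n : ℕ) :
    y.proj n ∈ stageSet X n (x.proj (n + 1)) := by
  rw [← stageRoot_proj y n]
  exact stage_le_iff.1 (h (n + 1)) (isLeast_stageRoot _).1

variable [CompactSpace X] [PriestleySpace X]

/-- The member `x (n + 1)` of stage `n + 1` is the set of the `n`-th coordinates of the points above
`x`: a point of `x (n + 1)` is continued upwards by relative openness of `x (n + 2)`, `x (n + 3)`
and so on. -/
theorem exists_ge_proj_eq (x : VG X) (n : ℕ) {c : Stage X n}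
    (hc : c ∈ stageSet X n (x.proj (n + 1))) : ∃ y : VG X, x ≤ y ∧ y.proj n = c := by
  obtain ⟨t, htc, ht⟩ := exists_thread (stageRoot X) (fun m => stageSet X m (x.proj (m + 1)))
    (fun m a ha => by
      have hle : x.proj (m + 1) ≤ a := by
        rw [← stageRoot_proj x (m + 1)]
        exact (isLeast_stageRoot _).2 ha
      exact stage_le_iff.1 hle (isLeast_stageRoot a).1)
    (fun m a ha => exists_mem_stageSet_stageRoot_eq
      (stageRoot_proj x (m + 1) ▸ (isLeast_stageRoot (x.proj (m + 2))).1) ha) c hc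
  refine ⟨⟨t, fun m => (ht m).2⟩, fun m => ?_, htc⟩
  rw [show x.1 m = stageRoot X m (x.proj (m + 1)) from (stageRoot_proj x m).symm]
  exact (isLeast_stageRoot _).2 (ht m).1

instance compactSpace : CompactSpace (VG X) := by
  have h : IsClosed {x : ∀ n, Stage X n | ∀ n, stageRoot X n (x (n + 1)) = x n} := by
    simp only [ofPred_forall]
    exact isClosed_iInter fun n =>
      isClosed_eq ((continuous_stageRoot n).comp (continuous_apply (n + 1))) (continuous_apply n)
  exact isCompact_iff_compactSpace.1 h.isCompact

instance priestleySpace : PriestleySpace (VG X) where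
  priestley {x y} h := by
    obtain ⟨n, hn⟩ := not_forall.1 (fun h' => h (le_iff_proj.2 h'))
    obtain ⟨U, hU, hU', hx, hy⟩ := exists_isClopen_upper_of_not_le hn
    exact ⟨proj n ⁻¹' U, hU.preimage (continuous_proj n), fun a b hab ha => hU' (hab n) ha, hx, hy⟩

/-- The kernels of the projections form a decreasing sequence of closed sets with the diagonal as
intersection, so some kernel is contained in the open set of pairs not separated by `K`. -/
theorem exists_saturated_of_isClopen {K : Set (VG X)} (hK : IsClopen K) :
    ∃ n, ∀ x y : VG X, x.proj n = y.proj n → x ∈ K → y ∈ K := by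
  have hcl : ∀ n, IsClosed {p : VG X × VG X | p.1.proj n = p.2.proj n} := fun n =>
    isClosed_eq ((continuous_proj n).comp continuous_fst) ((continuous_proj n).comp continuous_snd)
  have hopen : IsOpen (K ×ˢ Kᶜ)ᶜ :=
    (hK.isClosed.prod hK.compl.isClosed).isOpen_compl
  obtain ⟨n, hn⟩ := exists_subset_nhds_of_isCompact'
    (V := fun n => {p : VG X × VG X | p.1.proj n = p.2.proj n}) (U := (K ×ˢ Kᶜ)ᶜ)
    (directed_of_isDirected_le (antitone_nat_of_succ_le fun n p
      (hp : p.1.proj (n + 1) = p.2.proj (n + 1)) => by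
        change p.1.proj n = p.2.proj n
        rw [← stageRoot_proj, hp, stageRoot_proj]))
    (fun n => (hcl n).isCompact) hcl (by
      rintro ⟨x, y⟩ hxy
      obtain rfl : x = y := ext_proj fun n => mem_iInter.1 hxy n
      exact hopen.mem_nhds fun h => h.2 h.1)
  exact ⟨n, fun x y h hx => by_contra fun hy => hn (show (x, y) ∈ _ from h) ⟨hx, hy⟩⟩

instance esakiaSpace : EsakiaSpace (VG X) where
  isClopen_lowerClosure K hK := by
    refine ⟨isClosed_lowerClosure hK.isClosed, ?_⟩
    obtain ⟨n, hn⟩ := exists_saturated_of_isClopen hK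
    -- `K` is the preimage of an open set `O` of stage `n`, and `↓K` consists of those `x` for which
    -- the set `x (n + 1)` meets `O`.
    let O : Set (Stage X n) := (proj n '' Kᶜ)ᶜ
    have hO : IsOpen O :=
      (hK.compl.isClosed.isCompact.image (continuous_proj n)).isClosed.isOpen_compl
    have hKO : ∀ x : VG X, x ∈ K ↔ x.proj n ∈ O := by
      refine fun x => ⟨fun hx => ?_, fun hx => by_contra fun hxK => hx ⟨x, hxK, rfl⟩⟩
      rintro ⟨y, hy, hyx⟩
      exact hy (hn x y hyx.symm hx)
    convert (isOpen_setOf_stageSet_inter_nonempty hO).preimage (continuous_proj (n + 1)) using 1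
    ext x
    constructor
    · rintro ⟨y, hy, hxy⟩
      exact ⟨y.proj n, proj_mem_stageSet hxy n, (hKO y).1 hy⟩
    · rintro ⟨c, hc, hcO⟩
      obtain ⟨y, hxy, rfl⟩ := exists_ge_proj_eq x n hc
      exact ⟨y, (hKO y).2 hcO, hxy⟩

end VG

/-! ### Lifting to the limit -/

section Lift

variable {X Z : Type u} [TopologicalSpace X] [PartialOrder X] [CompactSpace X] [PriestleySpace X]
  [TopologicalSpace Z] [PartialOrder Z]

/-- A continuous p-morphism into the limit is determined by its first coordinate through this
recursion. -/
theorem stageSet_proj_map (q : EsakiaHom Z (VG X)) (z : Z) (n : ℕ) :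
    stageSet X n ((q z).proj (n + 1)) = (fun w => (q w).proj n) '' Ici z := by
  ext c
  constructor
  · intro hc
    obtain ⟨y, hzy, rfl⟩ := VG.exists_ge_proj_eq (q z) n hc
    obtain ⟨w, hzw, rfl⟩ := EsakiaHomClass.exists_map_eq_of_map_le q hzy
    exact ⟨w, hzw, rfl⟩
  · rintro ⟨w, hw, rfl⟩
    exact VG.proj_mem_stageSet (ContinuousOrderHomClass.map_monotone q hw) n

theorem esakiaHom_ext_base {q q' : EsakiaHom Z (VG X)} (h : ∀ z, (q z).base = (q' z).base) :
    q = q' := by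
  have key : ∀ n z, (q z).proj n = (q' z).proj n := by
    intro n
    induction n with
    | zero => exact h
    | succ n ih =>
      intro z
      apply stageSet_injective n
      rw [stageSet_proj_map, stageSet_proj_map]
      exact image_congr fun w _ => ih w
  exact EsakiaHom.ext fun z => VG.ext_proj fun n => key n z

theorem isOpen_lowerClosure_of_isOpen [EsakiaSpace Z] {O : Set Z} (hO : IsOpen O) :
    IsOpen (lowerClosure O : Set Z) := by
  rw [isOpen_iff_forall_mem_open]
  rintro x ⟨y, hy, hxy⟩
  obtain ⟨U, hU, hyU, hUO⟩ := compact_exists_isClopen_in_isOpen hO hy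
  exact ⟨lowerClosure U, lowerClosure_mono hUO, (EsakiaSpace.isClopen_lowerClosure U hU).isOpen,
    y, hyU, hxy⟩

/-- The properties of a map to stage `n` that allow it to be lifted to stage `n + 1`: it is
continuous, monotone and a p-morphism relative to the `n`-th map of the complex. -/
structure IsLiftable (n : ℕ) (q : Z → Stage X n) : Prop where
  continuous : Continuous q
  monotone : Monotone q
  exists_ge : ∀ w y, q w ≤ y → ∃ v, w ≤ v ∧
    (complexMap X n).toFun (q v) = (complexMap X n).toFun y

/-- The lift is forced to be `z ↦ q '' ↑z`. Its continuity is the point where `Z` has to be an Esakia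
space: the sets `{z | q '' ↑z meets U}` are the downsets of the open sets `q ⁻¹' U`. -/
theorem IsLiftable.exists_lift [EsakiaSpace Z] {n : ℕ} {q : Z → Stage X n} (hq : IsLiftable n q) :
    ∃ q' : Z → Stage X (n + 1), IsLiftable (n + 1) q' ∧ (∀ z, stageRoot X n (q' z) = q z) ∧
      ∀ z, stageSet X n (q' z) = q '' Ici z := by
  have hleast : ∀ z, IsLeast (q '' Ici z) (q z) := fun z =>
    ⟨⟨z, le_rfl, rfl⟩, by rintro _ ⟨w, hw, rfl⟩; exact hq.monotone hw⟩
  have hex : ∀ z, ∃ C : Stage X (n + 1), stageSet X n C = q '' Ici z := fun z =>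
    exists_stageSet_eq (isClosed_Ici.isCompact.image hq.continuous).isClosed (hleast z) (by
      rintro _ ⟨w, hw, rfl⟩ y hy
      obtain ⟨v, hwv, hv⟩ := hq.exists_ge w y hy
      exact ⟨q v, ⟨v, le_trans hw hwv, rfl⟩, hq.monotone hwv, hv⟩)
  choose q' hq' using hex
  have hroot : ∀ z, stageRoot X n (q' z) = q z := fun z =>
    stageRoot_eq ((hq' z).symm ▸ hleast z)
  refine ⟨q', ⟨?_, ?_, ?_⟩, hroot, hq'⟩
  · refine continuous_stage_of_isOpen_preimage (fun U hU => ?_) (fun U hU => ?_)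
    · convert (isClosed_lowerClosure (hU.isClosed_compl.preimage hq.continuous)).isOpen_compl
        using 1
      ext z
      rw [mem_ofPred_eq, hq', image_subset_iff]
      constructor
      · rintro h ⟨w, hw, hzw⟩
        exact hw (h hzw)
      · intro h w hzw
        by_contra hw
        exact h ⟨w, hw, hzw⟩
    · convert isOpen_lowerClosure_of_isOpen (hU.preimage hq.continuous) using 1
      ext z
      rw [mem_ofPred_eq, hq']
      constructor
      · rintro ⟨_, ⟨w, hw, rfl⟩, hwU⟩
        exact ⟨w, hwU, hw⟩
      · rintro ⟨w, hwU, hw⟩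
        exact ⟨q w, ⟨w, hw, rfl⟩, hwU⟩
  · intro z w hzw
    rw [stage_le_iff, hq', hq']
    exact image_mono (Ici_subset_Ici.2 hzw)
  · intro w C hC
    rw [stage_le_iff, hq'] at hC
    obtain ⟨v, hv, hvC⟩ := hC (isLeast_stageRoot C).1
    exact ⟨v, hv, (hroot v).trans hvC⟩

/-- Every continuous monotone map from an Esakia space to the base lifts to a continuous p-morphism
into the limit. -/
theorem exists_esakiaHom_base_eq [EsakiaSpace Z] (p : Z →Co X) :
    ∃ q : EsakiaHom Z (VG X), ∀ z, (q z).base = p z := by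
  have h0 : IsLiftable (X := X) 0 p :=
    ⟨map_continuous p, ContinuousOrderHomClass.map_monotone p, fun w _ _ => ⟨w, le_rfl, rfl⟩⟩
  choose next hnext hroot hset using fun (n : ℕ) (q : {q : Z → Stage X n // IsLiftable n q}) =>
    q.2.exists_lift
  let Q : ∀ n, {q : Z → Stage X n // IsLiftable n q} := fun n =>
    Nat.rec ⟨p, h0⟩ (fun m q => ⟨next m q, hnext m q⟩) n
  have hQroot : ∀ n z, stageRoot X n ((Q (n + 1)).1 z) = (Q n).1 z := fun n => hroot n (Q n)
  have hQset : ∀ n z, stageSet X n ((Q (n + 1)).1 z) = (Q n).1 '' Ici z := fun n => hset n (Q n)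
  let f : Z → VG X := fun z => ⟨fun n => (Q n).1 z, fun n => hQroot n z⟩
  have hf : Continuous f := VG.continuous_of_proj fun n => (Q n).2.continuous
  refine ⟨⟨⟨⟨f, fun z w hzw n => (Q n).2.monotone hzw⟩, hf⟩, fun {z y} hzy => ?_⟩, fun z => rfl⟩
  -- The sets of those `w ≥ z` that have the right `n`-th coordinate are nonempty, compact and
  -- decreasing in `n`.
  have hcl : ∀ n, IsClosed (Ici z ∩ (Q n).1 ⁻¹' {y.proj n}) := fun n =>
    isClosed_Ici.inter (isClosed_singleton.preimage (Q n).2.continuous)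
  obtain ⟨w, hw⟩ := IsCompact.nonempty_iInter_of_sequence_nonempty_isCompact_isClosed
    (fun n => Ici z ∩ (Q n).1 ⁻¹' {y.proj n})
    (by
      rintro n w ⟨hzw, hw⟩
      refine ⟨hzw, ?_⟩
      change (Q n).1 w = y.proj n
      rw [← hQroot, ← VG.stageRoot_proj]
      exact congrArg _ hw)
    (by
      intro n
      obtain ⟨w, hzw, hw⟩ := (hQset n z).subset (VG.proj_mem_stageSet (x := f z) hzy n)
      exact ⟨w, hzw, hw⟩)
    (hcl 0).isCompact hcl
  rw [mem_iInter] at hw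
  exact ⟨w, (hw 0).1, VG.ext_proj fun n => (hw n).2⟩

theorem existsUnique_esakiaHom_base_eq [EsakiaSpace Z] (p : Z →Co X) :
    ∃! q : EsakiaHom Z (VG X), ∀ z, (q z).base = p z := by
  obtain ⟨q, hq⟩ := exists_esakiaHom_base_eq p
  exact ⟨q, hq, fun q' hq' => esakiaHom_ext_base fun z => (hq' z).trans (hq z).symm⟩

end Lift

/-! ### The adjunction -/

/-- The projection of the limit to its base, as a continuous monotone map. -/
def VG.baseOrderHom {X : Type u} [TopologicalSpace X] [PartialOrder X] : VG X →Co X :=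
  ⟨⟨VG.base, fun _ _ h => VG.le_iff_proj.1 h 0⟩, VG.continuous_proj 0⟩

section Adjunction

variable (hE : ∀ X : Pries.{u}, EsakiaSpace (VG X.carrier))
  (hL : ∀ (X Y : Pries.{u}) (p : X.carrier →Co Y.carrier),
    ∃! q : EsakiaHom (VG X.carrier) (VG Y.carrier), ∀ x, (q x).base = p x.base)

theorem base_functorVG_map {X Y : Pries.{u}} (p : X ⟶ Y) (x : VG X.carrier) :
    VG.base (X := Y.carrier) (Esa.fn ((functorVG hE hL).map p) x) = Pries.fn p x.base :=
  (hL X Y p).choose_spec.1 x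

/-- The projection of the limit to its base, as a morphism of Priestley spaces. -/
def baseHom (X : Pries.{u}) : esaToPries.obj ((functorVG hE hL).obj X) ⟶ X :=
  VG.baseOrderHom (X := X.carrier)

/-- The lift of a continuous monotone map to a continuous p-morphism into the limit. -/
noncomputable def liftHom {Z : Esa.{u}} {X : Pries.{u}} (p : Z.carrier →Co X.carrier) :
    EsakiaHom Z.carrier (VG X.carrier) :=
  (exists_esakiaHom_base_eq p).choose

theorem base_liftHom {Z : Esa.{u}} {X : Pries.{u}} (p : Z.carrier →Co X.carrier) (z : Z.carrier) :
    (liftHom p z).base = p z :=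
  (exists_esakiaHom_base_eq p).choose_spec z

/-- Composition with the projection to the base is a bijection from continuous p-morphisms
into the limit to continuous monotone maps into the base. -/
noncomputable def homEquivVG (Z : Esa.{u}) (X : Pries.{u}) :
    (esaToPries.obj Z ⟶ X) ≃ (Z ⟶ (functorVG hE hL).obj X) where
  toFun p := liftHom (Z := Z) p
  invFun q := esaToPries.map q ≫ baseHom hE hL X
  left_inv p := ContinuousOrderHom.ext (base_liftHom (Z := Z) p)
  right_inv q := by
    have h : ∀ q : EsakiaHom Z.carrier (VG X.carrier), ∀ p : Z.carrier →Co X.carrier,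
        (∀ z, p z = (q z).base) → liftHom p = q := fun q p hp =>
      esakiaHom_ext_base fun z => (base_liftHom p z).trans (hp z)
    exact h q _ fun _ => rfl

/-- The adjunction whose counit is the projection to the base. -/
noncomputable def adjunctionVG : esaToPries.{u} ⊣ functorVG hE hL :=
  Adjunction.mkOfHomEquiv
    { homEquiv := homEquivVG hE hL
      homEquiv_naturality_left_symm := fun {Z' Z X} f q => by
        exact Category.assoc (esaToPries.map f) (esaToPries.map q) (baseHom hE hL X)
      homEquiv_naturality_right := fun {Z X Y} p f => by
        rw [← Equiv.eq_symm_apply]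
        refine ContinuousOrderHom.ext fun z => ?_
        refine Eq.trans ?_
          (base_functorVG_map hE hL f ((liftHom (Z := Z) p : EsakiaHom _ _) z)).symm
        exact congrArg (Pries.fn f) (base_liftHom (Z := Z) p z).symm }

theorem adjunctionVG_counit_app (X : Pries.{u}) :
    (adjunctionVG hE hL).counit.app X = baseHom hE hL X := by
  simp only [adjunctionVG, Adjunction.mkOfHomEquiv_counit_app]
  rfl

theorem base_adjunctionVG_unit (Z : Esa.{u}) (z : Z.carrier) :
    VG.base (X := Z.carrier) (Esa.fn ((adjunctionVG hE hL).unit.app Z) z) = z := by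
  have h := (adjunctionVG hE hL).left_triangle_components Z
  rw [adjunctionVG_counit_app] at h
  exact congrArg (fun p => Pries.fn p z) h

end Adjunction

end GhilardiComplex

open GhilardiComplex in
theorem mainTheorem1 :
    ∃ (hE : ∀ X : Pries.{u}, EsakiaSpace (VG X.carrier))
      (hL : ∀ (X Y : Pries.{u}) (p : X.carrier →Co Y.carrier),
        ∃! q : EsakiaHom (VG X.carrier) (VG Y.carrier), ∀ x, (q x).base = p x.base)
      (adj : esaToPries.{u} ⊣ functorVG hE hL),
      (∀ (X : Pries.{u}) (x : VG X.carrier),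
        Pries.fn (adj.counit.app X) x = x.base) ∧
      (∀ (Z : Esa.{u}) (z : Z.carrier),
        VG.base (X := Z.carrier) (Esa.fn (adj.unit.app Z) z) = z ∧
        ∀ n : ℕ,
          stageSet Z.carrier n
              (VG.proj (X := Z.carrier) (n + 1) (Esa.fn (adj.unit.app Z) z)) =
            {c | ∃ w : Z.carrier, z ≤ w ∧
              c = VG.proj (X := Z.carrier) n (Esa.fn (adj.unit.app Z) w)}) := by
  have hE (X : Pries.{u}) : EsakiaSpace (VG X.carrier) := VG.esakiaSpace
  have hL (X Y : Pries.{u}) (p : X.carrier →Co Y.carrier) :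
      ∃! q : EsakiaHom (VG X.carrier) (VG Y.carrier), ∀ x, (q x).base = p x.base :=
    existsUnique_esakiaHom_base_eq
      (p.comp VG.baseOrderHom)
  refine ⟨hE, hL, adjunctionVG hE hL, fun X x => ?_, fun Z z =>
    ⟨base_adjunctionVG_unit hE hL Z z, fun n => ?_⟩⟩
  · rw [adjunctionVG_counit_app]
    rfl
  · let η : EsakiaHom Z.carrier (VG Z.carrier) := (adjunctionVG hE hL).unit.app Z
    refine (stageSet_proj_map η z n).trans ?_
    ext c
    exact ⟨fun ⟨w, hw, h⟩ => ⟨w, hw, h.symm⟩, fun ⟨w, hw, h⟩ => ⟨w, hw, h.symm⟩⟩
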